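/- Let $m,n$ be natural numbers, $f\colon\mathbb{R}^n\to\mathbb{R}\cup\{+\infty\}$, $A\in\mathbb{R}^{m\times n}$, $b\in\mathbb{R}^m$, $\varepsilon\ge 0$ and $\alpha>0$. Let $\|\cdot\|$ be the Euclidean norm and $\mathcal{C}=\{x\in\mathbb{R}^n : \|Ax-b\|\le\varepsilon\}$. Assume: (C1) $f$ is closed, convex and proper; (C2) $A$ has full row rank or $\varepsilon>0$; (C3) $b$ lies in the image of $A$; (C4) $f$ is coercive (that is, $f(x)\to+\infty$ as $\|x\|\to\infty$) or $\mathcal{C}$ is bounded; (C5) there is $x\in\operatorname{ri}(\operatorname{dom} f)$, where $\operatorname{dom} f=\{x : f(x)<+\infty\}$, such that $Ax=b$ if $\varepsilon=0$, and $\|Ax-b\|<\varepsilon$ if $\varepsilon>0$. Write $\operatorname{prox}_{\alpha f}(x)=\operatorname{argmin}_{u\in\mathbb{R}^n}\,\alpha f(u)+\tfrac12\|u-x\|^2$. Given $z^1\in\mathbb{R}^n$, the proximal projection (PP) iteration is, for $k\ge 1$, $$x^k=\begin{cases} z^k & \text{if } \|Az^k-b\|\le\varepsilon,\\ z^k-A^\top(AA^\top+\varepsilon\tau_k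 I)^{-1}(Az^k-b) & \text{otherwise,}\end{cases}\qquad z^{k+1}=z^k+\operatorname{prox}_{\alpha f}(2x^k-z^k)-x^k,$$ where, in the second case, $\tau_k>0$ is a solution $\tau$ of $1=\tau\,\|(AA^\top+\varepsilon\tau I)^{-1}(Az^k-b)\|$. Then, for every $z^1\in\mathbb{R}^n$, the iteration generates exactly one pair of sequences $\{x^k\}$, $\{z^k\}$; $x^k$ is the Euclidean projection of $z^k$ onto $\mathcal{C}$ for all $k$; both sequences converge; and the limit of $\{x^k\}$ is a minimizer of $f$ over $\mathcal{C}$. Moreover, $\|Ax^k-b\|\le\varepsilon$ for all $k$. -/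

import Mathlib

open Filter Topology

namespace PP

/-- The epigraph of an extended-real-valued function, as a subset of `E × ℝ`. -/
def epigraph {E : Type*} (f : E → EReal) : Set (E × ℝ) :=
  {p | f p.1 ≤ (p.2 : EReal)}

/-- The effective domain of an extended-real-valued function. -/
def dom {E : Type*} (f : E → EReal) : Set E :=
  {x | f x < ⊤}

/-- `f` is closed (closed epigraph), convex (convex epigraph) and proper
(never `-∞`, and not identically `+∞`). -/
structure ClosedConvexProper {n : ℕ} (f : EuclideanSpace ℝ (Fin n) → EReal) : Prop where
  closed : IsClosed (epigraph f)
  convex : Convex ℝ (epigraph f)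
  ne_bot : ∀ x, f x ≠ ⊥
  nonempty_dom : (dom f).Nonempty

/-- `f` is coercive: `f x → +∞` as `‖x‖ → ∞`. -/
def Coercive {n : ℕ} (f : EuclideanSpace ℝ (Fin n) → EReal) : Prop :=
  Tendsto f (Bornology.cobounded (EuclideanSpace ℝ (Fin n))) (𝓝 ⊤)

/-- The constraint set `{x : ‖A x - b‖ ≤ ε}`, with Euclidean norms. -/
def constraintSet {m n : ℕ} (A : Matrix (Fin m) (Fin n) ℝ) (b : EuclideanSpace ℝ (Fin m))
    (ε : ℝ) : Set (EuclideanSpace ℝ (Fin n)) :=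
  {x | ‖A.toEuclideanLin x - b‖ ≤ ε}

/-- `p` belongs to `argmin_u α f(u) + ½ ‖u - x‖²`, i.e. `p = prox_{α f}(x)`. -/
def IsProx {n : ℕ} (α : ℝ) (f : EuclideanSpace ℝ (Fin n) → EReal)
    (x p : EuclideanSpace ℝ (Fin n)) : Prop :=
  IsMinOn (fun u => (α : EReal) * f u + ((1 / 2 * ‖u - x‖ ^ 2 : ℝ) : EReal)) Set.univ p

/-- `p` belongs to `argmin_{u ∈ C} ½ ‖u - x‖²`, i.e. `p` is the projection of `x` onto `C`. -/
def IsProjection {n : ℕ} (C : Set (EuclideanSpace ℝ (Fin n)))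
    (x p : EuclideanSpace ℝ (Fin n)) : Prop :=
  p ∈ C ∧ IsMinOn (fun u => 1 / 2 * ‖u - x‖ ^ 2) C p

/-- The vector `(A Aᵀ + ε τ I)⁻¹ (A x - b)`. -/
noncomputable def resolvedResidual {m n : ℕ} (A : Matrix (Fin m) (Fin n) ℝ)
    (b : EuclideanSpace ℝ (Fin m)) (ε τ : ℝ) (x : EuclideanSpace ℝ (Fin n)) :
    EuclideanSpace ℝ (Fin m) :=
  (A * A.transpose + (ε * τ) • (1 : Matrix (Fin m) (Fin m) ℝ))⁻¹.toEuclideanLin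
    (A.toEuclideanLin x - b)

/-- `τ` is a positive solution of `1 = τ ‖(A Aᵀ + ε τ I)⁻¹ (A x - b)‖`. -/
def IsTau {m n : ℕ} (A : Matrix (Fin m) (Fin n) ℝ) (b : EuclideanSpace ℝ (Fin m)) (ε : ℝ)
    (x : EuclideanSpace ℝ (Fin n)) (τ : ℝ) : Prop :=
  0 < τ ∧ 1 = τ * ‖resolvedResidual A b ε τ x‖

/-- The sequences `x`, `z` (indexed from `0`) are generated by the proximal projection iteration
with step size `α`. -/
structure IsPPSequence {m n : ℕ} (f : EuclideanSpace ℝ (Fin n) → EReal)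
    (A : Matrix (Fin m) (Fin n) ℝ) (b : EuclideanSpace ℝ (Fin m)) (ε α : ℝ)
    (x z : ℕ → EuclideanSpace ℝ (Fin n)) : Prop where
  x_of_le : ∀ k, ‖A.toEuclideanLin (z k) - b‖ ≤ ε → x k = z k
  x_of_lt : ∀ k, ε < ‖A.toEuclideanLin (z k) - b‖ →
    ∃ τ : ℝ, IsTau A b ε (z k) τ ∧
      x k = z k - A.transpose.toEuclideanLin (resolvedResidual A b ε τ (z k))
  z_succ : ∀ k, ∃ p, IsProx α f ((2 : ℝ) • x k - z k) p ∧ z (k + 1) = z k + p - x k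

end PP

namespace PP

/-! ### Convergence of firmly nonexpansive iterations -/

/-! The iteration is Douglas-Rachford splitting for the indicator of C = {‖Ax - b‖ ≤ ε} plus αf: it
iterates T z = z + P z - X z, where X z is the projection of z onto C and P z is the proximal point
of 2 X z - z. Both points satisfy variational inequalities; adding them over two starting points
makes T firmly nonexpansive (`IsDRStep.firmlyNonexpansive`). Once T has a fixed point, z^k converges
to one, and x^k = X z^k follows since X is nonexpansive. At a fixed point X z = P z, and adding the
two inequalities there shows that this point minimizes f over C (`IsDRStep.le_of_eq`).

Two facts remain. First, the explicit formula must be the projection: w = (AAᵀ + ετI)⁻¹(Az - b) acts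
as a multiplier, and τ exists by the intermediate value theorem (`variational_inequality_of_isTau`,
`exists_isTau`). Second, a fixed point must exist (`exists_stationary`): coercivity of f or
boundedness of C gives a minimizer x, and the qualification condition gives a subgradient v of αf at
x with -v normal to C, so that z = x - v is fixed. For ε > 0 this is Hahn-Banach separation with a
Slater point; for ε = 0 the set C has empty interior unless A = 0, and M. Riesz extension is used
with a relative interior point. -/

/-- The iterates of a firmly nonexpansive map with a fixed point, on a proper space, converge to a
fixed point. -/
theorem exists_tendsto_of_firmlyNonexpansive {E : Type*} [NormedAddCommGroup E] [ProperSpace E]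
    {T : E → E}
    (hT : ∀ u v, ‖T u - T v‖ ^ 2 + ‖(u - T u) - (v - T v)‖ ^ 2 ≤ ‖u - v‖ ^ 2)
    (hfix : ∃ w, T w = w) {z : ℕ → E} (hz : ∀ k, z (k + 1) = T (z k)) :
    ∃ w, T w = w ∧ Tendsto z atTop (𝓝 w) := by
  have hanti : ∀ w, T w = w → Antitone fun k => ‖z k - w‖ := by
    intro w hw
    refine antitone_nat_of_succ_le fun k => ?_
    have h := hT (z k) w
    rw [hw, ← hz] at h
    exact (sq_le_sq₀ (norm_nonneg _) (norm_nonneg _)).1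
      (by nlinarith [sq_nonneg ‖z k - z (k + 1) - (w - w)‖])
  have hlip : ∀ u v, ‖T u - T v‖ ≤ ‖u - v‖ := fun u v =>
    (sq_le_sq₀ (norm_nonneg _) (norm_nonneg _)).1
      (by nlinarith [hT u v, sq_nonneg ‖u - T u - (v - T v)‖])
  have hcont : Continuous T :=
    (LipschitzWith.of_dist_le_mul (K := 1) fun u v => by
      simpa [dist_eq_norm] using hlip u v).continuous
  obtain ⟨w₀, hw₀⟩ := hfix
  obtain ⟨l, hl⟩ : ∃ l, Tendsto (fun k => ‖z k - w₀‖) atTop (𝓝 l) :=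
    ⟨_, tendsto_atTop_ciInf (hanti w₀ hw₀) ⟨0, by rintro _ ⟨k, rfl⟩; exact norm_nonneg _⟩⟩
  -- Firm nonexpansiveness against `w₀` bounds the squared residual by the drop of ‖z k - w₀‖², a
  -- convergent sequence.
  have hres : Tendsto (fun k => ‖z k - T (z k)‖) atTop (𝓝 0) := by
    have h1 : Tendsto (fun k => ‖z k - w₀‖ ^ 2 - ‖z (k + 1) - w₀‖ ^ 2) atTop (𝓝 0) := by
      have := (hl.pow 2).sub (((tendsto_add_atTop_iff_nat 1).2 hl).pow 2)
      simpa using this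
    have h2 : Tendsto (fun k => ‖z k - T (z k)‖ ^ 2) atTop (𝓝 0) := by
      refine squeeze_zero (fun k => sq_nonneg _) (fun k => ?_) h1
      have h := hT (z k) w₀
      rw [hw₀, sub_self, sub_zero, ← hz] at h
      rw [← hz]
      linarith
    have h3 := h2.sqrt
    simpa [Real.sqrt_sq (norm_nonneg _)] using h3
  obtain ⟨w, -, φ, hφ, hw⟩ := tendsto_subseq_of_bounded
    (Metric.isBounded_closedBall (x := w₀) (r := ‖z 0 - w₀‖)) (x := z) fun k => by
      rw [Metric.mem_closedBall, dist_eq_norm]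
      exact hanti w₀ hw₀ (Nat.zero_le k)
  have hTw : T w = w := by
    have h1 : Tendsto (fun k => ‖z (φ k) - T (z (φ k))‖) atTop (𝓝 ‖w - T w‖) :=
      (hw.sub ((hcont.tendsto w).comp hw)).norm
    have h2 := tendsto_nhds_unique h1 (hres.comp hφ.tendsto_atTop)
    exact (sub_eq_zero.1 (norm_eq_zero.1 h2)).symm
  refine ⟨w, hTw, ?_⟩
  rw [tendsto_iff_norm_sub_tendsto_zero]
  have h1 : Tendsto (fun k => ‖z (φ k) - w‖) atTop (𝓝 0) :=
    tendsto_iff_norm_sub_tendsto_zero.1 hw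
  -- The distance to `w` is also nonincreasing, so convergence along the subsequence carries over to
  -- the whole sequence.
  refine tendsto_order.2 ⟨fun a ha => Eventually.of_forall fun k => ha.trans_le (norm_nonneg _),
    fun a ha => ?_⟩
  obtain ⟨k, hk⟩ := ((tendsto_order.1 h1).2 a ha).exists
  exact eventually_atTop.2 ⟨φ k, fun j hj => (hanti w hTw hj).trans_lt hk⟩

/-! ### Douglas-Rachford steps and proximal variational inequalities -/

section Hilbert

variable {E : Type*} [NormedAddCommGroup E] [InnerProductSpace ℝ E]

/-- The pair `(x, p)` of projection and proximal points that a step of the Douglas-Rachford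
iteration attaches to `z`, each described by its variational inequality. -/
structure IsDRStep (C D : Set E) (g : E → ℝ) (z x p : E) : Prop where
  mem_left : x ∈ C
  left : ∀ u ∈ C, inner ℝ (z - x) (u - x) ≤ 0
  mem_right : p ∈ D
  right : ∀ u ∈ D, inner ℝ ((2 : ℝ) • x - z - p) (u - p) ≤ g u - g p

/-- With differences dz, dx, dp, the claim amounts to ⟨dz, dx - dp⟩ ≥ ‖dp - dx‖². This is exactly
the sum of the monotonicity inequalities ⟨dz - dx, dx⟩ ≥ 0 and ⟨2dx - dz - dp, dp⟩ ≥ 0. -/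
theorem IsDRStep.firmlyNonexpansive {C D : Set E} {g : E → ℝ} {z x p z' x' p' : E}
    (h : IsDRStep C D g z x p) (h' : IsDRStep C D g z' x' p') :
    ‖(z + p - x) - (z' + p' - x')‖ ^ 2 + ‖(z - (z + p - x)) - (z' - (z' + p' - x'))‖ ^ 2 ≤
      ‖z - z'‖ ^ 2 := by
  have h1 := h.left x' h'.mem_left
  have h2 := h'.left x h.mem_left
  have h3 := h.right p' h'.mem_right
  have h4 := h'.right p h.mem_right
  have e1 : (z + p - x) - (z' + p' - x') = (z - z') + ((p - p') - (x - x')) := by abel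
  have e2 : (z - (z + p - x)) - (z' - (z' + p' - x')) = -((p - p') - (x - x')) := by abel
  have k1 : 0 ≤ inner ℝ ((z - z') - (x - x')) (x - x') := by
    have : (z - z') - (x - x') = (z - x) - (z' - x') := by abel
    rw [this, inner_sub_left, ← neg_sub x' x, inner_neg_right, neg_sub]
    linarith
  have k2 : 0 ≤ inner ℝ ((2 : ℝ) • (x - x') - (z - z') - (p - p')) (p - p') := by
    have : (2 : ℝ) • (x - x') - (z - z') - (p - p') =
        ((2 : ℝ) • x - z - p) - ((2 : ℝ) • x' - z' - p') := by
      rw [smul_sub]; abel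
    rw [this, inner_sub_left, ← neg_sub p' p, inner_neg_right, neg_sub]
    linarith
  rw [e1, e2, norm_neg, norm_add_sq_real]
  generalize z - z' = dz at *
  generalize x - x' = dx at *
  generalize p - p' = dp at *
  simp only [inner_sub_left, inner_smul_left, inner_sub_right, norm_sub_sq_real,
    real_inner_self_eq_norm_sq, RCLike.conj_to_real] at *
  linarith [real_inner_comm dx dp]

/-- Used twice: for z = z' it gives uniqueness of the projection point, and in general it transfers
convergence from z to x. -/
theorem IsDRStep.norm_left_sub_le {C D : Set E} {g : E → ℝ} {z x p z' x' p' : E}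
    (h : IsDRStep C D g z x p) (h' : IsDRStep C D g z' x' p') : ‖x - x'‖ ≤ ‖z - z'‖ := by
  have h1 := h.left x' h'.mem_left
  have h2 := h'.left x h.mem_left
  have k1 : 0 ≤ inner ℝ ((z - z') - (x - x')) (x - x') := by
    have : (z - z') - (x - x') = (z - x) - (z' - x') := by abel
    rw [this, inner_sub_left, ← neg_sub x' x, inner_neg_right, neg_sub]
    linarith
  rw [inner_sub_left, real_inner_self_eq_norm_sq] at k1
  have k2 := real_inner_le_norm (z - z') (x - x')
  by_contra! hlt
  nlinarith [norm_nonneg (z - z'), norm_nonneg (x - x')]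

/-- At a fixed point of the Douglas-Rachford iteration, the projection point is a minimizer. -/
theorem IsDRStep.le_of_eq {C D : Set E} {g : E → ℝ} {z x : E} (h : IsDRStep C D g z x x) :
    ∀ u ∈ C, u ∈ D → g x ≤ g u := by
  intro u hC hD
  have h1 := h.left u hC
  have h2 := h.right u hD
  have : (2 : ℝ) • x - z - x = -(z - x) := by rw [two_smul]; abel
  rw [this, inner_neg_left] at h2
  linarith

/-- Uniqueness of the point characterized by a proximal variational inequality. -/
theorem eq_of_proximal_inequality {D : Set E} {g : E → ℝ} {y p q : E} (hp : p ∈ D) (hq : q ∈ D)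
    (h : ∀ u ∈ D, inner ℝ (y - p) (u - p) ≤ g u - g p)
    (h' : ∀ u ∈ D, inner ℝ (y - q) (u - q) ≤ g u - g q) : p = q := by
  have h1 := h q hq
  have h2 := h' p hp
  have : inner ℝ (y - p) (q - p) + inner ℝ (y - q) (p - q) = ‖p - q‖ ^ 2 := by
    rw [← neg_sub p q, inner_neg_right, neg_add_eq_sub, ← inner_sub_left,
      ← real_inner_self_eq_norm_sq]
    congr 1; abel
  have h3 : ‖p - q‖ = 0 := by nlinarith [sq_nonneg ‖p - q‖]
  exact sub_eq_zero.1 (norm_eq_zero.1 h3)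

/-- A minimizer of `g + ½ ‖· - y‖²` satisfies the proximal variational inequality. -/
theorem proximal_inequality_of_isMin {D : Set E} {g : E → ℝ} (hg : ConvexOn ℝ D g) {y p : E}
    (hp : p ∈ D)
    (hmin : ∀ u ∈ D, g p + 1 / 2 * ‖p - y‖ ^ 2 ≤ g u + 1 / 2 * ‖u - y‖ ^ 2) :
    ∀ u ∈ D, inner ℝ (y - p) (u - p) ≤ g u - g p := by
  intro u hu
  -- Compare p with p + t(u - p), divide by t, and let t → 0 below.
  have key : ∀ t : ℝ, 0 < t → t ≤ 1 →
      inner ℝ (y - p) (u - p) ≤ g u - g p + t * (1 / 2 * ‖u - p‖ ^ 2) := by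
    intro t ht0 ht1
    have hc := hg.2 hp hu (sub_nonneg.2 ht1) ht0.le (by ring)
    have hm := hmin _ (hg.1 hp hu (sub_nonneg.2 ht1) ht0.le (by ring))
    have e : ((1 - t) • p + t • u) - y = (p - y) + t • (u - p) := by
      rw [sub_smul, smul_sub, one_smul]; abel
    rw [e, norm_add_sq_real, norm_smul, inner_smul_right, Real.norm_eq_abs, mul_pow, sq_abs] at hm
    simp only [smul_eq_mul] at hc
    rw [← neg_sub p y, inner_neg_left]
    have : 0 ≤ t * (g u - g p + t * (1 / 2 * ‖u - p‖ ^ 2) + inner ℝ (p - y) (u - p)) := by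
      nlinarith
    have := nonneg_of_mul_nonneg_right this ht0
    linarith
  refine le_of_forall_pos_le_add fun δ hδ => ?_
  have hpos : 0 < 1 / 2 * ‖u - p‖ ^ 2 + 1 := by positivity
  have h := key (min 1 (δ / (1 / 2 * ‖u - p‖ ^ 2 + 1))) (by positivity) (min_le_left _ _)
  have h1 : min 1 (δ / (1 / 2 * ‖u - p‖ ^ 2 + 1)) * (1 / 2 * ‖u - p‖ ^ 2) ≤ δ :=
    calc _ ≤ δ / (1 / 2 * ‖u - p‖ ^ 2 + 1) * (1 / 2 * ‖u - p‖ ^ 2 + 1) := by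
          gcongr
          · exact min_le_right _ _
          · linarith
      _ = δ := by field_simp
  linarith

theorem isMin_of_proximal_inequality {D : Set E} {g : E → ℝ} {y p : E}
    (h : ∀ u ∈ D, inner ℝ (y - p) (u - p) ≤ g u - g p) :
    ∀ u ∈ D, g p + 1 / 2 * ‖p - y‖ ^ 2 ≤ g u + 1 / 2 * ‖u - y‖ ^ 2 := by
  intro u hu
  have h1 := h u hu
  have e : u - y = (u - p) - (y - p) := by abel
  rw [e, norm_sub_sq_real (u - p), norm_sub_rev p y, real_inner_comm]
  nlinarith [sq_nonneg ‖u - p‖]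

end Hilbert

/-! ### Subgradients and qualification conditions -/

section Duality

/-- A point in the relative interior is in the algebraic interior relative to the affine span. -/
theorem exists_pos_add_smul_mem_of_mem_intrinsicInterior {E : Type*} [NormedAddCommGroup E]
    [NormedSpace ℝ E] {D : Set E} {x₀ : E} (hx₀ : x₀ ∈ intrinsicInterior ℝ D) {v : E}
    (hv : v ∈ vectorSpan ℝ D) : ∃ t : ℝ, 0 < t ∧ x₀ + t • v ∈ D := by
  obtain ⟨y, hy, rfl⟩ := mem_intrinsicInterior.1 hx₀
  have hmem : ∀ t : ℝ, (y : E) + t • v ∈ affineSpan ℝ D := fun t => by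
    rw [add_comm]
    exact AffineSubspace.vadd_mem_of_mem_direction
      (by rw [direction_affineSpan]; exact Submodule.smul_mem _ _ hv) y.2
  let γ : ℝ → affineSpan ℝ D := fun t => ⟨(y : E) + t • v, hmem t⟩
  have hγ : Continuous γ := by
    apply Continuous.subtype_mk
    fun_prop
  have h0 : γ 0 = y := Subtype.ext (by simp [γ])
  have hnhds : ∀ᶠ t in 𝓝 (0 : ℝ), γ t ∈ ((↑) ⁻¹' D : Set (affineSpan ℝ D)) := by
    apply hγ.continuousAt.eventually_mem
    rw [h0]
    exact mem_interior_iff_mem_nhds.1 hy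
  obtain ⟨t, ht, ht0⟩ := ((hnhds.filter_mono nhdsWithin_le_nhds).and
    (self_mem_nhdsWithin (s := Set.Ioi (0 : ℝ)))).exists
  exact ⟨t, ht0, ht⟩

/-- Lagrange multipliers for minimization of a convex function over an affine subspace meeting the
algebraic relative interior of the domain. -/
theorem exists_linear_minorant_of_subspace {E : Type*} [AddCommGroup E] [Module ℝ E]
    {D : Set E} {g : E → ℝ} (hg : ConvexOn ℝ D g) (K : Submodule ℝ E) {x₀ : E} (hx₀ : x₀ ∈ D)
    (hcore : ∀ v ∈ vectorSpan ℝ D, ∃ t : ℝ, 0 < t ∧ x₀ + t • v ∈ D) {c : ℝ}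
    (hc : ∀ u ∈ D, u - x₀ ∈ K → c ≤ g u) :
    ∃ l : E →ₗ[ℝ] ℝ, (∀ v ∈ K, l v = 0) ∧ ∀ u ∈ D, c + l (u - x₀) ≤ g u := by
  -- Q only fills up the space: the functional below lives on (K ⊕ Q) × ℝ, so that every direction
  -- is covered by the span of D, K and Q.
  obtain ⟨Q, hQ⟩ := (vectorSpan ℝ D ⊔ K).exists_isCompl
  let cone : ConvexCone ℝ (E × ℝ) :=
    -- The cone generated by the epigraph of g - c translated by x₀; allowing r = 0 adds only the
    -- upward vertical ray.
    { carrier := {w | ∃ r : ℝ, 0 ≤ r ∧ ∃ d ∈ D, w.1 = r • (d - x₀) ∧ r * (g d - c) ≤ w.2}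
      smul_mem' := by
        rintro a ha w ⟨r, hr, d, hd, h1, h2⟩
        refine ⟨a * r, by positivity, d, hd, ?_, ?_⟩
        · rw [Prod.smul_fst, h1, smul_smul]
        · rw [Prod.smul_snd, smul_eq_mul, mul_assoc]
          gcongr
      add_mem' := by
        rintro w ⟨r, hr, d, hd, h1, h2⟩ w' ⟨r', hr', d', hd', h1', h2'⟩
        rcases hr.eq_or_lt with rfl | hrpos
        · refine ⟨r', hr', d', hd', ?_, ?_⟩
          · rw [Prod.fst_add, h1, h1', zero_smul, zero_add]
          · rw [Prod.snd_add]; linarith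
        have hs : 0 < r + r' := by linarith
        have hsum : r / (r + r') + r' / (r + r') = 1 := by field_simp
        refine ⟨r + r', hs.le, (r / (r + r')) • d + (r' / (r + r')) • d',
          hg.1 hd hd' (by positivity) (by positivity) hsum, ?_, ?_⟩
        · rw [Prod.fst_add, h1, h1', smul_sub, smul_sub, smul_sub, smul_add, smul_smul, smul_smul,
            mul_div_cancel₀ _ hs.ne', mul_div_cancel₀ _ hs.ne', add_smul]
          abel
        · have := hg.2 hd hd' (div_nonneg hr hs.le) (div_nonneg hr' hs.le) hsum
          have h3 := mul_le_mul_of_nonneg_left this hs.le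
          rw [smul_eq_mul, smul_eq_mul, mul_add, ← mul_assoc, ← mul_assoc,
            mul_div_cancel₀ _ hs.ne', mul_div_cancel₀ _ hs.ne'] at h3
          rw [Prod.snd_add]
          nlinarith }
  let s : PointedCone ℝ (E × ℝ) := cone.toPointedCone ⟨0, le_rfl, x₀, hx₀, by simp, by simp⟩
  have hs : ∀ w : E × ℝ, w ∈ s ↔
      ∃ r : ℝ, 0 ≤ r ∧ ∃ d ∈ D, w.1 = r • (d - x₀) ∧ r * (g d - c) ≤ w.2 := fun w => Iff.rfl
  let f : E × ℝ →ₗ.[ℝ] ℝ :=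
    { domain := (K ⊔ Q).prod ⊤
      toFun := (LinearMap.snd ℝ E ℝ).comp (Submodule.subtype _) }
  have hf : ∀ w : f.domain, f w = (w : E × ℝ).2 := fun w => rfl
  -- Extend (v, t) ↦ t. It is nonnegative on the cone because c bounds g from below along K; the
  -- Q-component of a cone point vanishes. The cofinality condition comes from `hcore`.
  obtain ⟨G, hG, hGs⟩ := riesz_extension s f
    (by
      rintro ⟨⟨u, t⟩, hw⟩ hws
      rw [hf]
      obtain ⟨r, hr, d, hd, h1, h2⟩ := (hs _).1 hws
      rcases hr.eq_or_lt with rfl | hrpos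
      · simpa using h2
      have huKQ : u ∈ K ⊔ Q := hw.1
      have hdu : d - x₀ = r⁻¹ • u := by
        simp only at h1
        rw [h1, smul_smul, inv_mul_cancel₀ hrpos.ne', one_smul]
      have hdV : d - x₀ ∈ vectorSpan ℝ D := vsub_mem_vectorSpan ℝ hd hx₀
      obtain ⟨k, hk, q, hq, hkq⟩ := Submodule.mem_sup.1
        (show d - x₀ ∈ K ⊔ Q by rw [hdu]; exact Submodule.smul_mem _ _ huKQ)
      have hq0 : q = 0 := by
        refine Submodule.disjoint_def.1 hQ.disjoint q ?_ hq
        have : q = (d - x₀) - k := by rw [← hkq]; abel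
        rw [this]
        exact Submodule.sub_mem _ (Submodule.mem_sup_left hdV) (Submodule.mem_sup_right hk)
      rw [hq0, add_zero] at hkq
      have := hc d hd (hkq ▸ hk)
      exact (mul_nonneg hr (sub_nonneg.2 this)).trans h2)
    (by
      rintro ⟨v, a⟩
      obtain ⟨w, hw, q, hq, hwq⟩ := Submodule.mem_sup.1
        (show v ∈ (vectorSpan ℝ D ⊔ K) ⊔ Q by rw [hQ.sup_eq_top]; trivial)
      obtain ⟨v', hv', k, hk, hvk⟩ := Submodule.mem_sup.1 hw
      obtain ⟨t, ht, htD⟩ := hcore v' hv'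
      refine ⟨⟨(-(k + q), t⁻¹ * (g (x₀ + t • v') - c) - a), ?_, trivial⟩, ?_⟩
      · exact Submodule.neg_mem _ (Submodule.add_mem _ (Submodule.mem_sup_left hk)
          (Submodule.mem_sup_right hq))
      · refine (hs _).2 ⟨t⁻¹, by positivity, _, htD, ?_, ?_⟩
        · rw [add_sub_cancel_left, smul_smul, inv_mul_cancel₀ ht.ne', one_smul, Prod.fst_add,
            ← hwq, ← hvk]
          simp only
          abel
        · simp)
  refine ⟨-(G.comp (LinearMap.inl ℝ E ℝ)), fun v hv => ?_, fun u hu => ?_⟩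
  · have := hG ⟨(v, 0), Submodule.mem_sup_left hv, trivial⟩
    rw [hf] at this
    simpa using this
  · have h1 := hGs (u - x₀, g u - c) ((hs _).2 ⟨1, zero_le_one, u, hu, by simp, by simp⟩)
    have h2 : G (0, g u - c) = g u - c :=
      (hG ⟨(0, g u - c), Submodule.zero_mem _, trivial⟩).trans (hf _)
    have h3 : ((u - x₀, g u - c) : E × ℝ) = (u - x₀, 0) + (0, g u - c) := by simp
    rw [h3, map_add, h2] at h1
    simp only [LinearMap.neg_apply, LinearMap.comp_apply, LinearMap.inl_apply]
    linarith

/-- Multipliers for minimization of a convex function over a convex set whose interior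
meets the domain. -/
theorem exists_linear_minorant_of_interior {E : Type*} [NormedAddCommGroup E] [NormedSpace ℝ E]
    {C D : Set E} {g : E → ℝ} (hg : ConvexOn ℝ D g) (hC : Convex ℝ C)
    (hint : (D ∩ interior C).Nonempty) {x : E} (hxC : x ∈ C) (hxD : x ∈ D)
    (hmin : ∀ u ∈ C, u ∈ D → g x ≤ g u) :
    ∃ l : E →L[ℝ] ℝ, (∀ u ∈ C, l x ≤ l u) ∧ ∀ u ∈ D, g x + l (u - x) ≤ g u := by
  obtain ⟨x₀, hx₀D, hx₀C⟩ := hint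
  -- Separate the open set below the optimal value over the interior of C from the epigraph of g.
  obtain ⟨φ, c, hφ1, hφ2⟩ := geometric_hahn_banach_open
    (s := interior C ×ˢ Set.Iio (g x)) (t := {w : E × ℝ | w.1 ∈ D ∧ g w.1 ≤ w.2})
    (hC.interior.prod (convex_Iio _)) (isOpen_interior.prod isOpen_Iio) hg.convex_epigraph
    (by
      rw [Set.disjoint_left]
      rintro ⟨u, t⟩ ⟨hu, ht⟩ ⟨hu', ht'⟩
      exact absurd (hmin u (interior_subset hu) hu') (not_le.2 (lt_of_le_of_lt ht' ht)))
  let l : E →L[ℝ] ℝ := φ.comp (ContinuousLinearMap.inl ℝ E ℝ)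
  let β : ℝ := φ (0, 1)
  have hφ : ∀ u t, φ (u, t) = l u + t * β := by
    intro u t
    have : ((u, t) : E × ℝ) = (u, 0) + t • (0, 1) := by simp
    rw [this, map_add, map_smul]
    rfl
  have hlt : ∀ u ∈ interior C, ∀ t, t < g x → l u + t * β < c := fun u hu t ht => by
    rw [← hφ]; exact hφ1 _ ⟨hu, ht⟩
  have hge : ∀ u ∈ D, ∀ t, g u ≤ t → c ≤ l u + t * β := fun u hu t ht => by
    rw [← hφ]; exact hφ2 _ ⟨hu, ht⟩
  -- The Slater point lies under both sets' projections, so the separating hyperplane is not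
  -- vertical and can be normalized by β.
  have hβ : 0 < β := by
    have h1 := hlt x₀ hx₀C (g x - 1) (by linarith)
    have h2 := hge x₀ hx₀D (max (g x₀) (g x)) (le_max_left _ _)
    have h3 : g x ≤ max (g x₀) (g x) := le_max_right _ _
    by_contra! hβ
    nlinarith
  have hle : ∀ u ∈ interior C, l u + g x * β ≤ c := by
    intro u hu
    refine le_of_forall_pos_le_add fun δ hδ => ?_
    have h := hlt u hu (g x - δ / β) (by linarith [div_pos hδ hβ])
    rw [sub_mul, div_mul_cancel₀ _ hβ.ne'] at h
    linarith
  have hleC : ∀ u ∈ C, l u + g x * β ≤ c := by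
    intro u hu
    have hcl : u ∈ closure (interior C) := by
      rw [hC.closure_interior_eq_closure_of_nonempty_interior ⟨x₀, hx₀C⟩]
      exact subset_closure hu
    have hclosed : IsClosed {u | l u + g x * β ≤ c} :=
      isClosed_le (by fun_prop) continuous_const
    exact closure_minimal (fun u hu => hle u hu) hclosed hcl
  -- The minimizer touches both sides, so the separating constant is attained at x.
  have heq : l x + g x * β = c := le_antisymm (hleC x hxC) (hge x hxD _ le_rfl)
  refine ⟨-(β⁻¹ • l), fun u hu => ?_, fun u hu => ?_⟩
  · have h := hleC u hu
    simp only [neg_apply, smul_apply, smul_eq_mul]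
    have : β⁻¹ * l u ≤ β⁻¹ * l x := by gcongr; linarith
    linarith
  · have h := hge u hu _ le_rfl
    simp only [neg_apply, smul_apply, smul_eq_mul, map_sub]
    have h2 : β⁻¹ * (l x - l u) ≤ g u - g x := by
      rw [inv_mul_le_iff₀ hβ]; linarith
    linarith

end Duality

end PP

namespace PP

/-! ### The projection onto the constraint set -/

section Projection

variable {m n : ℕ} (A : Matrix (Fin m) (Fin n) ℝ) (b : EuclideanSpace ℝ (Fin m))

theorem inner_toEuclideanLin_transpose (w : EuclideanSpace ℝ (Fin m))
    (v : EuclideanSpace ℝ (Fin n)) :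
    inner ℝ (A.transpose.toEuclideanLin w) v = inner ℝ w (A.toEuclideanLin v) := by
  rw [← Matrix.conjTranspose_eq_transpose_of_trivial,
    Matrix.toEuclideanLin_conjTranspose_eq_adjoint, LinearMap.adjoint_inner_left]

theorem isUnit_det_gram_add_smul_one {s : ℝ} (hs : 0 < s) :
    IsUnit (A * A.transpose + s • (1 : Matrix (Fin m) (Fin m) ℝ)).det := by
  have h1 : (A * A.transpose).PosSemidef := by
    rw [← Matrix.conjTranspose_eq_transpose_of_trivial]
    exact Matrix.posSemidef_self_mul_conjTranspose A
  exact (Matrix.PosDef.posSemidef_add h1 (Matrix.PosDef.one.smul hs)).det_pos.ne'.isUnit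

theorem isUnit_det_gram_of_rank_eq (hA : A.rank = m) : IsUnit (A * A.transpose).det := by
  rw [← Matrix.isUnit_iff_isUnit_det, ← Matrix.mulVec_surjective_iff_isUnit]
  have h : LinearMap.range (A * A.transpose).mulVecLin = ⊤ := by
    apply Submodule.eq_top_of_finrank_eq
    rw [← Matrix.rank, Matrix.rank_self_mul_transpose, hA, Module.finrank_fin_fun]
  exact LinearMap.range_eq_top.1 h

/-- For ε = 0 full row rank makes the Gram matrix invertible; for ε > 0 the regularization makes it
positive definite. -/
theorem isUnit_det_of_rank_eq_or_pos {ε τ : ℝ} (hε : 0 ≤ ε) (h : A.rank = m ∨ 0 < ε)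
    (hτ : 0 < τ) :
    IsUnit (A * A.transpose + (ε * τ) • (1 : Matrix (Fin m) (Fin m) ℝ)).det := by
  rcases hε.eq_or_lt with rfl | hpos
  · rw [zero_mul, zero_smul, add_zero]
    exact isUnit_det_gram_of_rank_eq A (h.resolve_right (lt_irrefl _))
  · exact isUnit_det_gram_add_smul_one A (mul_pos hpos hτ)

variable {A} in
theorem gram_resolvedResidual {ε τ : ℝ}
    (h : IsUnit (A * A.transpose + (ε * τ) • (1 : Matrix (Fin m) (Fin m) ℝ)).det)
    (x : EuclideanSpace ℝ (Fin n)) :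
    A.toEuclideanLin (A.transpose.toEuclideanLin (resolvedResidual A b ε τ x)) +
      (ε * τ) • resolvedResidual A b ε τ x = A.toEuclideanLin x - b := by
  have h1 : (A * A.transpose + (ε * τ) • (1 : Matrix (Fin m) (Fin m) ℝ)).toEuclideanLin
      (resolvedResidual A b ε τ x) = A.toEuclideanLin x - b := by
    rw [resolvedResidual, ← LinearMap.comp_apply, ← Matrix.toLpLin_mul,
      Matrix.mul_nonsing_inv _ h, Matrix.toLpLin_one, LinearMap.id_apply]
  rw [map_add, map_smul, LinearMap.add_apply, LinearMap.smul_apply, Matrix.toLpLin_one,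
    Matrix.toLpLin_mul 2 2 2, LinearMap.comp_apply, LinearMap.id_apply] at h1
  exact h1

variable {A b} in
/-- The explicit formula produces a point of the constraint set that satisfies the variational
inequality of the projection. -/
theorem variational_inequality_of_isTau {ε τ : ℝ} (hε : 0 ≤ ε) (h : A.rank = m ∨ 0 < ε)
    {z : EuclideanSpace ℝ (Fin n)} (hτ : IsTau A b ε z τ) :
    z - A.transpose.toEuclideanLin (resolvedResidual A b ε τ z) ∈ constraintSet A b ε ∧
    ∀ u ∈ constraintSet A b ε,
      inner ℝ (z - (z - A.transpose.toEuclideanLin (resolvedResidual A b ε τ z)))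
        (u - (z - A.transpose.toEuclideanLin (resolvedResidual A b ε τ z))) ≤ 0 := by
  have hgram := gram_resolvedResidual b (isUnit_det_of_rank_eq_or_pos A hε h hτ.1) z
  obtain ⟨hτ0, hτ1⟩ := hτ
  generalize resolvedResidual A b ε τ z = w at *
  -- The new residual is ετw, of norm ε because τ‖w‖ = 1. Cauchy-Schwarz against w then gives the
  -- variational inequality.
  have hres : A.toEuclideanLin (z - A.transpose.toEuclideanLin w) - b = (ε * τ) • w := by
    rw [map_sub, eq_comm, ← sub_eq_zero]
    rw [← sub_eq_zero] at hgram
    rw [← hgram]; abel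
  refine ⟨?_, fun u hu => ?_⟩
  · rw [constraintSet, Set.mem_ofPred_eq, hres, norm_smul, Real.norm_of_nonneg (by positivity),
      mul_assoc, ← hτ1, mul_one]
  · rw [sub_sub_cancel, inner_toEuclideanLin_transpose]
    have e : A.toEuclideanLin (u - (z - A.transpose.toEuclideanLin w)) =
        (A.toEuclideanLin u - b) - (ε * τ) • w := by
      rw [← hres, map_sub]; abel
    rw [e, inner_sub_right, inner_smul_right, real_inner_self_eq_norm_sq]
    have h1 := real_inner_le_norm w (A.toEuclideanLin u - b)
    have h2 : ‖w‖ * ‖A.toEuclideanLin u - b‖ ≤ ‖w‖ * ε := by gcongr; exact hu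
    have h3 : ε * τ * ‖w‖ ^ 2 = ‖w‖ * ε := by
      calc ε * τ * ‖w‖ ^ 2 = ‖w‖ * ε * (τ * ‖w‖) := by ring
        _ = _ := by rw [← hτ1, mul_one]
    linarith

theorem continuousOn_resolvedResidual {ε : ℝ} (hε : 0 < ε) (z : EuclideanSpace ℝ (Fin n)) :
    ContinuousOn (fun τ => resolvedResidual A b ε τ z) (Set.Ioi 0) := by
  have hM : Continuous fun τ : ℝ =>
      A * A.transpose + (ε * τ) • (1 : Matrix (Fin m) (Fin m) ℝ) := by fun_prop
  have hinv : ContinuousOn (fun τ : ℝ =>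
      (A * A.transpose + (ε * τ) • (1 : Matrix (Fin m) (Fin m) ℝ))⁻¹) (Set.Ioi 0) := by
    simp only [Matrix.inv_def, Ring.inverse_eq_inv']
    refine ContinuousOn.smul (hM.matrix_det.continuousOn.inv₀ fun τ hτ => ?_)
      hM.matrix_adjugate.continuousOn
    exact (isUnit_det_gram_add_smul_one A (mul_pos hε hτ)).ne_zero
  have hlin : Continuous fun M : Matrix (Fin m) (Fin m) ℝ =>
      M.toEuclideanLin (A.toEuclideanLin z - b) :=
    LinearMap.continuous_of_finiteDimensional
      ((LinearMap.applyₗ (A.toEuclideanLin z - b)).comp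
        (Matrix.toEuclideanLin (𝕜 := ℝ) (m := Fin m) (n := Fin m)).toLinearMap)
  exact hlin.comp_continuousOn hinv

-- Intermediate value theorem for τ ↦ τ‖w(τ)‖. Writing b = Ay controls w as τ → 0 even when AAᵀ is
-- singular; ‖Az - b‖ > ε forces the value up to 1 for large τ.
variable {A b} in
theorem exists_isTau_of_pos {ε : ℝ} (hε : 0 < ε) (hb : b ∈ LinearMap.range A.toEuclideanLin)
    {z : EuclideanSpace ℝ (Fin n)} (hz : ε < ‖A.toEuclideanLin z - b‖) :
    ∃ τ, IsTau A b ε z τ := by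
  obtain ⟨y, rfl⟩ := hb
  set b := A.toEuclideanLin y with hbdef
  have hgram : ∀ τ : ℝ, 0 < τ → _ := fun τ hτ =>
    gram_resolvedResidual b (isUnit_det_gram_add_smul_one A (mul_pos hε hτ)) z
  set w : ℝ → EuclideanSpace ℝ (Fin m) := fun τ => resolvedResidual A b ε τ z with hw
  have hsmall : ∀ τ, 0 < τ → τ * ‖z - y‖ ^ 2 ≤ 4 * ε → τ * ‖w τ‖ ≤ 1 := by
    intro τ hτ hle
    have h1 : inner ℝ (A.toEuclideanLin (A.transpose.toEuclideanLin (w τ)) + (ε * τ) • w τ) (w τ)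
        = inner ℝ (A.toEuclideanLin z - b) (w τ) := by rw [← hgram τ hτ]
    rw [hbdef, ← map_sub, real_inner_comm, real_inner_comm (w τ) (A.toEuclideanLin (z - y)),
      ← inner_toEuclideanLin_transpose, inner_add_right, inner_smul_right,
      ← inner_toEuclideanLin_transpose, real_inner_self_eq_norm_sq,
      real_inner_self_eq_norm_sq] at h1
    have h2 := real_inner_le_norm (A.transpose.toEuclideanLin (w τ)) (z - y)
    -- Pairing the equation for w with w gives ‖Aᵀw‖² + ετ‖w‖² = ⟨Aᵀw, z - y⟩; then complete the
    -- square.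
    have h3 : ε * τ * ‖w τ‖ ^ 2 ≤ ‖z - y‖ ^ 2 / 4 := by
      nlinarith [sq_nonneg (‖A.transpose.toEuclideanLin (w τ)‖ - ‖z - y‖ / 2)]
    have h4 : ε * (τ * ‖w τ‖) ^ 2 ≤ ε * 1 := by
      calc ε * (τ * ‖w τ‖) ^ 2 = τ * (ε * τ * ‖w τ‖ ^ 2) := by ring
        _ ≤ τ * (‖z - y‖ ^ 2 / 4) := by gcongr
        _ ≤ ε * 1 := by linarith
    have h5 := le_of_mul_le_mul_left h4 hε
    exact (sq_le_one_iff₀ (by positivity)).1 h5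
  obtain ⟨K, hK0, hK⟩ : ∃ K : ℝ, 0 < K ∧ ∀ v : EuclideanSpace ℝ (Fin m),
      ‖A.toEuclideanLin (A.transpose.toEuclideanLin v)‖ ≤ K * ‖v‖ := by
    obtain ⟨K, hK0, hK⟩ := (LinearMap.toContinuousLinearMap
      (A.toEuclideanLin ∘ₗ A.transpose.toEuclideanLin)).bound
    exact ⟨K, hK0, hK⟩
  have hlarge : ∀ τ, 0 < τ → K ≤ τ * (‖A.toEuclideanLin z - b‖ - ε) → 1 ≤ τ * ‖w τ‖ := by
    intro τ hτ hle
    by_contra! hlt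
    have h1 : ‖A.toEuclideanLin z - b‖ ≤ K * ‖w τ‖ + ε * τ * ‖w τ‖ := by
      rw [← hgram τ hτ]
      refine (norm_add_le _ _).trans ?_
      rw [norm_smul, Real.norm_of_nonneg (by positivity)]
      gcongr
      exact hK _
    have h2 : K * ‖w τ‖ ≤ (τ * ‖w τ‖) * (‖A.toEuclideanLin z - b‖ - ε) := by
      calc K * ‖w τ‖ ≤ τ * (‖A.toEuclideanLin z - b‖ - ε) * ‖w τ‖ := by gcongr
        _ = _ := by ring
    have h3 : τ * ‖w τ‖ * ‖A.toEuclideanLin z - b‖ < 1 * ‖A.toEuclideanLin z - b‖ := by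
      gcongr
      linarith
    nlinarith
  have hd : 0 < ‖A.toEuclideanLin z - b‖ - ε := sub_pos.2 hz
  set τ₀ := 4 * ε / (‖z - y‖ ^ 2 + 1) with hτ₀
  have hτ₀pos : 0 < τ₀ := by positivity
  set τ₁ := max τ₀ (K / (‖A.toEuclideanLin z - b‖ - ε)) with hτ₁
  have h0 : τ₀ * ‖w τ₀‖ ≤ 1 := by
    refine hsmall τ₀ hτ₀pos ?_
    rw [hτ₀, div_mul_eq_mul_div, div_le_iff₀ (by positivity)]
    nlinarith
  have h1 : 1 ≤ τ₁ * ‖w τ₁‖ := by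
    refine hlarge τ₁ (lt_max_of_lt_left hτ₀pos) ?_
    rw [← div_le_iff₀ hd]
    exact le_max_right _ _
  have hcont : ContinuousOn (fun τ => τ * ‖w τ‖) (Set.Icc τ₀ τ₁) :=
    continuousOn_id.mul ((continuousOn_resolvedResidual A b hε z).mono
      fun τ hτ => hτ₀pos.trans_le hτ.1).norm
  obtain ⟨τ, hτ, hτ1⟩ := intermediate_value_Icc (le_max_left _ _) hcont ⟨h0, h1⟩
  exact ⟨τ, hτ₀pos.trans_le hτ.1, hτ1.symm⟩

-- For ε = 0 the vector w does not depend on τ, so τ = 1/‖w‖ works.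
variable {A b} in
theorem exists_isTau {ε : ℝ} (hε : 0 ≤ ε) (h : A.rank = m ∨ 0 < ε)
    (hb : b ∈ LinearMap.range A.toEuclideanLin)
    {z : EuclideanSpace ℝ (Fin n)} (hz : ε < ‖A.toEuclideanLin z - b‖) :
    ∃ τ, IsTau A b ε z τ := by
  rcases hε.eq_or_lt with rfl | hpos
  · have hw : ∀ τ τ', resolvedResidual A b 0 τ z = resolvedResidual A b 0 τ' z := fun τ τ' => by
      simp only [resolvedResidual, zero_mul]
    have hne : resolvedResidual A b 0 1 z ≠ 0 := by
      intro h0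
      have := gram_resolvedResidual b (isUnit_det_of_rank_eq_or_pos A hε h one_pos) z
      rw [h0, map_zero, map_zero, smul_zero, add_zero] at this
      rw [← this, norm_zero] at hz
      exact lt_irrefl _ hz
    have hpos := norm_pos_iff.2 hne
    refine ⟨‖resolvedResidual A b 0 1 z‖⁻¹, inv_pos.2 hpos, ?_⟩
    rw [hw ‖resolvedResidual A b 0 1 z‖⁻¹ 1, inv_mul_cancel₀ hpos.ne']
  · exact exists_isTau_of_pos hpos hb hz

theorem convex_constraintSet (ε : ℝ) : Convex ℝ (constraintSet A b ε) := by
  have : constraintSet A b ε = A.toEuclideanLin ⁻¹' Metric.closedBall b ε := by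
    ext; simp [constraintSet, dist_eq_norm]
  rw [this]
  exact (convex_closedBall b ε).linear_preimage A.toEuclideanLin

theorem continuous_residual_norm :
    Continuous fun x => ‖A.toEuclideanLin x - b‖ :=
  ((LinearMap.continuous_of_finiteDimensional A.toEuclideanLin).sub continuous_const).norm

theorem isClosed_constraintSet (ε : ℝ) : IsClosed (constraintSet A b ε) :=
  isClosed_le (continuous_residual_norm A b) continuous_const

theorem isProjection_of_variational_inequality {C : Set (EuclideanSpace ℝ (Fin n))}
    {z x : EuclideanSpace ℝ (Fin n)} (hx : x ∈ C) (h : ∀ u ∈ C, inner ℝ (z - x) (u - x) ≤ 0) :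
    IsProjection C z x := by
  refine ⟨hx, fun u hu => ?_⟩
  have := isMin_of_proximal_inequality (g := fun _ => 0) (D := C) (y := z) (p := x)
    (by simpa using h) u hu
  simpa using this

end Projection

end PP

namespace PP

/-! ### Closed convex proper functions -/

namespace ClosedConvexProper

variable {n : ℕ} {f : EuclideanSpace ℝ (Fin n) → EReal}

theorem coe_toReal (hf : ClosedConvexProper f) {x : EuclideanSpace ℝ (Fin n)} (hx : x ∈ dom f) :
    ((f x).toReal : EReal) = f x :=
  EReal.coe_toReal (ne_of_lt hx) (hf.ne_bot x)

theorem toReal_le_iff (hf : ClosedConvexProper f) {x : EuclideanSpace ℝ (Fin n)} (hx : x ∈ dom f)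
    {t : ℝ} : (f x).toReal ≤ t ↔ f x ≤ t := by
  rw [← hf.coe_toReal hx, EReal.coe_le_coe_iff, EReal.toReal_coe]

theorem mem_dom_of_le {x : EuclideanSpace ℝ (Fin n)} {t : ℝ} (h : f x ≤ t) : x ∈ dom f :=
  h.trans_lt (EReal.coe_lt_top t)

theorem convexOn_toReal (hf : ClosedConvexProper f) :
    ConvexOn ℝ (dom f) fun x => (f x).toReal := by
  have key : ∀ x ∈ dom f, ∀ y ∈ dom f, ∀ a b : ℝ, 0 ≤ a → 0 ≤ b → a + b = 1 →
      f (a • x + b • y) ≤ ((a * (f x).toReal + b * (f y).toReal : ℝ) : EReal) := by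
    intro x hx y hy a b ha hb hab
    exact hf.convex (x := (x, (f x).toReal)) (hf.coe_toReal hx).ge
      (y := (y, (f y).toReal)) (hf.coe_toReal hy).ge ha hb hab
  refine ⟨fun x hx y hy a b ha hb hab => mem_dom_of_le (key x hx y hy a b ha hb hab),
    fun x hx y hy a b ha hb hab => ?_⟩
  have h := key x hx y hy a b ha hb hab
  exact (hf.toReal_le_iff (mem_dom_of_le h)).2 h

theorem lowerSemicontinuous (hf : ClosedConvexProper f) : LowerSemicontinuous f := by
  rw [lowerSemicontinuous_iff_isClosed_preimage]
  intro y
  induction y with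
  | bot =>
    have : f ⁻¹' Set.Iic ⊥ = ∅ := by
      ext x; simpa using hf.ne_bot x
    rw [this]; exact isClosed_empty
  | coe r =>
    exact hf.closed.preimage (f := fun x => (x, r)) (by fun_prop)
  | top =>
    rw [Set.Iic_top, Set.preimage_univ]; exact isClosed_univ

/-- A closed convex proper function decreases at most linearly. -/
theorem exists_linear_lower_bound (hf : ClosedConvexProper f) {x₀ : EuclideanSpace ℝ (Fin n)}
    (hx₀ : x₀ ∈ dom f) : ∃ c : ℝ, 0 ≤ c ∧ ∀ u ∈ dom f, -(c * (1 + ‖u - x₀‖)) ≤ (f u).toReal := by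
  obtain ⟨q, hq, hqmin⟩ := LowerSemicontinuousOn.exists_isMinOn
    ⟨x₀, Metric.mem_closedBall_self zero_le_one⟩ (isCompact_closedBall x₀ (1 : ℝ))
    (hf.lowerSemicontinuous.lowerSemicontinuousOn _)
  have hqmin' : ∀ u ∈ Metric.closedBall x₀ 1, f q ≤ f u := fun u hu => hqmin hu
  have hqdom : q ∈ dom f :=
    lt_of_le_of_lt (hqmin' x₀ (Metric.mem_closedBall_self zero_le_one)) (show f x₀ < ⊤ from hx₀)
  set M := (f q).toReal
  set g₀ := (f x₀).toReal
  have hM : ∀ u ∈ dom f, ‖u - x₀‖ ≤ 1 → M ≤ (f u).toReal := by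
    intro u hu hle
    rw [hf.toReal_le_iff hqdom, hf.coe_toReal hu]
    exact hqmin' u (by rwa [Metric.mem_closedBall, dist_eq_norm])
  refine ⟨|M| + |g₀|, by positivity, fun u hu => ?_⟩
  have hMabs := neg_abs_le M
  have hgabs := le_abs_self g₀
  have hM0 := abs_nonneg M
  have hg0 := abs_nonneg g₀
  rcases le_or_gt ‖u - x₀‖ 1 with hle | hgt
  · have := hM u hu hle
    nlinarith [norm_nonneg (u - x₀)]
  -- Outside the unit ball, apply convexity at the point of the segment from x₀ to u at distance 1
  -- from x₀, where f is at least M.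
  · set t := ‖u - x₀‖
    have ht : 0 < t := by linarith
    have hinv : t⁻¹ ≤ 1 := inv_le_one_of_one_le₀ hgt.le
    have hconv := hf.convexOn_toReal
    have hmem := hconv.1 hx₀ hu (sub_nonneg.2 hinv) (inv_nonneg.2 ht.le) (by ring)
    have hle := hconv.2 hx₀ hu (sub_nonneg.2 hinv) (inv_nonneg.2 ht.le) (by ring)
    have hball := hM _ hmem (by
      have : (1 - t⁻¹) • x₀ + t⁻¹ • u - x₀ = t⁻¹ • (u - x₀) := by
        rw [sub_smul, smul_sub, one_smul]; abel
      rw [this, norm_smul, Real.norm_of_nonneg (inv_nonneg.2 ht.le), inv_mul_cancel₀ ht.ne'])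
    have h1 : M ≤ (1 - t⁻¹) * g₀ + t⁻¹ * (f u).toReal := hball.trans hle
    have h2 : t * M ≤ (t - 1) * g₀ + (f u).toReal := by
      have := mul_le_mul_of_nonneg_left h1 ht.le
      have e : t * ((1 - t⁻¹) * g₀ + t⁻¹ * (f u).toReal) = (t - 1) * g₀ + (f u).toReal := by
        field_simp
      rwa [e] at this
    nlinarith

theorem isProx_iff (hf : ClosedConvexProper f) {α : ℝ} (hα : 0 < α)
    {y p : EuclideanSpace ℝ (Fin n)} :
    IsProx α f y p ↔ p ∈ dom f ∧ ∀ u ∈ dom f,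
      α * (f p).toReal + 1 / 2 * ‖p - y‖ ^ 2 ≤ α * (f u).toReal + 1 / 2 * ‖u - y‖ ^ 2 := by
  have hdom : ∀ u ∈ dom f, (α : EReal) * f u + ((1 / 2 * ‖u - y‖ ^ 2 : ℝ) : EReal) =
      ((α * (f u).toReal + 1 / 2 * ‖u - y‖ ^ 2 : ℝ) : EReal) := by
    intro u hu
    rw [EReal.coe_add, EReal.coe_mul α, hf.coe_toReal hu]
  have htop : ∀ u ∉ dom f, (α : EReal) * f u + ((1 / 2 * ‖u - y‖ ^ 2 : ℝ) : EReal) = ⊤ := by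
    intro u hu
    have : f u = ⊤ := not_lt_top_iff.1 hu
    rw [this, EReal.coe_mul_top_of_pos hα, EReal.top_add_coe]
  constructor
  · intro h
    have hp : p ∈ dom f := by
      by_contra hp
      obtain ⟨u, hu⟩ := hf.nonempty_dom
      have := h (Set.mem_univ u)
      simp only [Set.mem_ofPred_eq] at this
      rw [htop p hp, hdom u hu] at this
      exact absurd this (not_le.2 (EReal.coe_lt_top _))
    refine ⟨hp, fun u hu => ?_⟩
    have := h (Set.mem_univ u)
    simp only [Set.mem_ofPred_eq] at this
    rwa [hdom p hp, hdom u hu, EReal.coe_le_coe_iff] at this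
  · rintro ⟨hp, h⟩ u -
    simp only [Set.mem_ofPred_eq]
    by_cases hu : u ∈ dom f
    · rw [hdom p hp, hdom u hu, EReal.coe_le_coe_iff]
      exact h u hu
    · rw [htop u hu]
      exact le_top

/-- Minimizing the continuous real function F over the closed epigraph avoids extended-real
arithmetic. The quadratic term beats the linear lower bound, so the part of the epigraph with F ≤ R
is compact. -/
theorem exists_isProx (hf : ClosedConvexProper f) {α : ℝ} (hα : 0 < α)
    (y : EuclideanSpace ℝ (Fin n)) : ∃ p, IsProx α f y p := by
  obtain ⟨x₀, hx₀⟩ := hf.nonempty_dom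
  obtain ⟨c, hc, hlow⟩ := hf.exists_linear_lower_bound hx₀
  let F : EuclideanSpace ℝ (Fin n) × ℝ → ℝ := fun w => α * w.2 + 1 / 2 * ‖w.1 - y‖ ^ 2
  have hF : Continuous F := by fun_prop
  set R := F (x₀, (f x₀).toReal) with hR
  set d := ‖y - x₀‖ with hd
  set H := |R + α * c * (1 + d)| with hH
  -- Chosen so that q > B gives q ≥ 1 and q/2 - αc > H + 1/2, hence q(q/2 - αc) > H, which
  -- contradicts F ≤ R.
  set B := 2 * (α * c) + 2 * H + 1 with hB
  have hαc : 0 ≤ α * c := by positivity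
  have hH0 : 0 ≤ H := abs_nonneg _
  have hd0 : 0 ≤ d := norm_nonneg _
  have hcompact : IsCompact (epigraph f ∩ {w | F w ≤ R}) := by
    refine ((isCompact_closedBall y B).prod
      (isCompact_Icc (a := -(c * (1 + B + d))) (b := R / α))).of_isClosed_subset
      (hf.closed.inter (isClosed_le hF continuous_const)) ?_
    rintro ⟨u, t⟩ ⟨hu, hle⟩
    have hu' : f u ≤ t := hu
    have hudom : u ∈ dom f := mem_dom_of_le hu'
    have hle' : α * t + 1 / 2 * ‖u - y‖ ^ 2 ≤ R := hle
    have hgt : (f u).toReal ≤ t := (hf.toReal_le_iff hudom).2 hu'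
    have htri : ‖u - x₀‖ ≤ ‖u - y‖ + d := norm_sub_le_norm_sub_add_norm_sub u y x₀
    have ht : -(c * (1 + (‖u - y‖ + d))) ≤ t := by
      refine le_trans ?_ ((hlow u hudom).trans hgt)
      gcongr
    have hq0 : 0 ≤ ‖u - y‖ := norm_nonneg _
    have hq : ‖u - y‖ ≤ B := by
      by_contra! hlt
      have h1 : -(α * c * (1 + (‖u - y‖ + d))) ≤ α * t := by
        have := mul_le_mul_of_nonneg_left ht hα.le
        linarith
      have h2 : R + α * c * (1 + d) ≤ H := le_abs_self _
      have h3 : H + 1 / 2 < 1 / 2 * ‖u - y‖ - α * c := by linarith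
      nlinarith
    refine ⟨by rwa [Metric.mem_closedBall, dist_eq_norm], ?_, ?_⟩
    · refine le_trans ?_ ht
      have : c * (1 + (‖u - y‖ + d)) ≤ c * (1 + B + d) := by
        rw [add_assoc]; gcongr
      simpa using this
    · change t ≤ R / α
      rw [le_div_iff₀ hα]
      nlinarith [sq_nonneg ‖u - y‖]
  obtain ⟨⟨p, t⟩, ⟨hp, hpR⟩, hmin⟩ := hcompact.exists_isMinOn
    ⟨(x₀, (f x₀).toReal), (hf.coe_toReal hx₀).ge, le_refl R⟩ hF.continuousOn
  have hp' : f p ≤ t := hp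
  have hpdom : p ∈ dom f := mem_dom_of_le hp'
  refine ⟨p, (hf.isProx_iff hα).2 ⟨hpdom, fun u hu => ?_⟩⟩
  have h1 : F (p, (f p).toReal) ≤ F (p, t) := by
    have := (hf.toReal_le_iff hpdom).2 hp'
    simp only [F]
    gcongr
  refine h1.trans ?_
  rcases le_or_gt (F (u, (f u).toReal)) R with hle | hgt
  · exact hmin (⟨(hf.coe_toReal hu).ge, hle⟩ :
      ((u, (f u).toReal) : EuclideanSpace ℝ (Fin n) × ℝ) ∈ epigraph f ∩ {w | F w ≤ R})
  · exact hpR.trans hgt.le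

theorem proximal_inequality (hf : ClosedConvexProper f) {α : ℝ} (hα : 0 < α)
    {y p : EuclideanSpace ℝ (Fin n)} (h : IsProx α f y p) :
    p ∈ dom f ∧
      ∀ u ∈ dom f, inner ℝ (y - p) (u - p) ≤ α * (f u).toReal - α * (f p).toReal := by
  obtain ⟨hp, hmin⟩ := (hf.isProx_iff hα).1 h
  exact ⟨hp, proximal_inequality_of_isMin (hf.convexOn_toReal.smul hα.le) hp hmin⟩

/-- The sublevel set of f at a feasible point, cut with C, is compact under either alternative. -/
theorem exists_isMinOn (hf : ClosedConvexProper f) {C : Set (EuclideanSpace ℝ (Fin n))}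
    (hC : IsClosed C) (hne : (dom f ∩ C).Nonempty)
    (hbdd : Coercive f ∨ Bornology.IsBounded C) :
    ∃ x ∈ C, x ∈ dom f ∧ IsMinOn f C x := by
  obtain ⟨x₀, hx₀, hx₀C⟩ := hne
  have hclosed : IsClosed (C ∩ f ⁻¹' Set.Iic (f x₀)) :=
    hC.inter (hf.lowerSemicontinuous.isClosed_preimage _)
  have hbounded : Bornology.IsBounded (C ∩ f ⁻¹' Set.Iic (f x₀)) := by
    rcases hbdd with h | h
    · have h1 : ∀ᶠ x in Bornology.cobounded (EuclideanSpace ℝ (Fin n)), f x₀ < f x :=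
        h.eventually_const_lt hx₀
      have h2 : Bornology.IsBounded {x | f x₀ < f x}ᶜ := Bornology.isBounded_compl_iff.2 h1
      exact h2.subset fun x hx => not_lt.2 (show f x ≤ f x₀ from hx.2)
    · exact h.subset Set.inter_subset_left
  obtain ⟨x, ⟨hxC, hx⟩, hmin⟩ := LowerSemicontinuousOn.exists_isMinOn
    (s := C ∩ f ⁻¹' Set.Iic (f x₀)) ⟨x₀, hx₀C, le_refl (f x₀)⟩
    (Metric.isCompact_of_isClosed_isBounded hclosed hbounded)
    (hf.lowerSemicontinuous.lowerSemicontinuousOn _)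
  have hx' : f x ≤ f x₀ := hx
  refine ⟨x, hxC, show f x < ⊤ from hx'.trans_lt hx₀, fun u hu => ?_⟩
  rcases le_or_gt (f u) (f x₀) with hle | hgt
  · exact hmin ⟨hu, hle⟩
  · exact hx'.trans hgt.le

end ClosedConvexProper

/-! ### Convergence of the proximal projection iteration -/

section Iteration

variable {m n : ℕ} {f : EuclideanSpace ℝ (Fin n) → EReal} {A : Matrix (Fin m) (Fin n) ℝ}
  {b : EuclideanSpace ℝ (Fin m)} {ε α : ℝ}

/-- A minimizer over the constraint set is a stationary point of the Douglas-Rachford iteration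
for a suitable `z`. -/
theorem exists_stationary (hε : 0 ≤ ε) (hα : 0 < α) (hf : ClosedConvexProper f)
    (hbdd : Coercive f ∨ Bornology.IsBounded (constraintSet A b ε))
    (hqual : ∃ x ∈ intrinsicInterior ℝ (dom f),
      (ε = 0 → A.toEuclideanLin x = b) ∧ (0 < ε → ‖A.toEuclideanLin x - b‖ < ε)) :
    ∃ z x, IsDRStep (constraintSet A b ε) (dom f) (fun u => α * (f u).toReal) z x x := by
  obtain ⟨x₀, hx₀, hzero, hpos⟩ := hqual
  have hx₀D : x₀ ∈ dom f := intrinsicInterior_subset hx₀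
  have hx₀C : x₀ ∈ constraintSet A b ε := by
    rcases hε.eq_or_lt with h | h
    · simp [constraintSet, hzero h.symm, hε]
    · exact (hpos h).le
  obtain ⟨x, hxC, hxD, hmin⟩ :=
    hf.exists_isMinOn (isClosed_constraintSet A b ε) ⟨x₀, hx₀D, hx₀C⟩ hbdd
  have hg : ConvexOn ℝ (dom f) fun u => α * (f u).toReal := hf.convexOn_toReal.smul hα.le
  have hmin' : ∀ u ∈ constraintSet A b ε, u ∈ dom f → α * (f x).toReal ≤ α * (f u).toReal := by
    intro u hu huD
    gcongr
    rw [hf.toReal_le_iff hxD, hf.coe_toReal huD]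
    exact hmin hu
  obtain ⟨l, hl1, hl2⟩ : ∃ l : EuclideanSpace ℝ (Fin n) →L[ℝ] ℝ,
      (∀ u ∈ constraintSet A b ε, l x ≤ l u) ∧
      ∀ u ∈ dom f, α * (f x).toReal + l (u - x) ≤ α * (f u).toReal := by
    rcases hε.eq_or_lt with h | h
    · subst h
      have hmem : ∀ u, u ∈ constraintSet A b 0 ↔ A.toEuclideanLin u = b := fun u => by
        rw [constraintSet, Set.mem_ofPred_eq, norm_le_zero_iff, sub_eq_zero]
      have hker : ∀ u v, u ∈ constraintSet A b 0 → v ∈ constraintSet A b 0 →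
          u - v ∈ LinearMap.ker A.toEuclideanLin := fun u v hu hv => by
        rw [LinearMap.mem_ker, map_sub, (hmem u).1 hu, (hmem v).1 hv, sub_self]
      obtain ⟨l, hl1, hl2⟩ := exists_linear_minorant_of_subspace hg
        (LinearMap.ker A.toEuclideanLin) hx₀D
        (fun v hv => exists_pos_add_smul_mem_of_mem_intrinsicInterior hx₀ hv)
        (c := α * (f x).toReal) (fun u hu hK => hmin' u (by
          rw [LinearMap.mem_ker, map_sub, hzero rfl, sub_eq_zero] at hK
          exact (hmem u).2 hK) hu)
      refine ⟨LinearMap.toContinuousLinearMap l, fun u hu => ?_, fun u hu => ?_⟩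
      · have := hl1 _ (hker u x hu hxC)
        rw [map_sub, sub_eq_zero] at this
        simp [this]
      -- The multiplier was based at x₀; it vanishes on x - x₀, so it can be rebased at x.
      · have h1 := hl1 _ (hker x x₀ hxC hx₀C)
        have h2 := hl2 u hu
        have e : u - x₀ = (u - x) + (x - x₀) := by abel
        rw [e, map_add, h1, add_zero] at h2
        simpa using h2
    · refine exists_linear_minorant_of_interior hg (convex_constraintSet A b ε)
        ⟨x₀, hx₀D, ?_⟩ hxC hxD hmin'
      refine mem_interior.2 ⟨{u | ‖A.toEuclideanLin u - b‖ < ε}, fun u (hu : _ < ε) => hu.le,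
        isOpen_lt (continuous_residual_norm A b) continuous_const, hpos h⟩
  let v := (InnerProductSpace.toDual ℝ (EuclideanSpace ℝ (Fin n))).symm l
  have hv : ∀ u, inner ℝ v u = l u := fun u => InnerProductSpace.toDual_symm_apply
  -- With z = x - v one has z - x = -v, normal to C, and 2x - z - x = v, a subgradient of αf.
  refine ⟨x - v, x, hxC, fun u hu => ?_, hxD, fun u hu => ?_⟩
  · rw [sub_sub_cancel_left, inner_neg_left, hv, map_sub]
    linarith [hl1 u hu]
  · have e : (2 : ℝ) • x - (x - v) - x = v := by rw [two_smul]; abel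
    rw [e, hv]
    linarith [hl2 u hu]

/-- The projection step of the iteration. -/
def IsProjectionStep (A : Matrix (Fin m) (Fin n) ℝ) (b : EuclideanSpace ℝ (Fin m)) (ε : ℝ)
    (z x : EuclideanSpace ℝ (Fin n)) : Prop :=
  (‖A.toEuclideanLin z - b‖ ≤ ε → x = z) ∧
  (ε < ‖A.toEuclideanLin z - b‖ → ∃ τ : ℝ, IsTau A b ε z τ ∧
    x = z - A.transpose.toEuclideanLin (resolvedResidual A b ε τ z))

theorem exists_isProjectionStep (hε : 0 ≤ ε) (hA : A.rank = m ∨ 0 < ε)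
    (hb : b ∈ LinearMap.range A.toEuclideanLin) (z : EuclideanSpace ℝ (Fin n)) :
    ∃ x, IsProjectionStep A b ε z x := by
  rcases le_or_gt ‖A.toEuclideanLin z - b‖ ε with hle | hgt
  · exact ⟨z, fun _ => rfl, fun h => absurd hle (not_le.2 h)⟩
  · obtain ⟨τ, hτ⟩ := exists_isTau hε hA hb hgt
    exact ⟨_, fun h => absurd h (not_le.2 hgt), fun _ => ⟨τ, hτ, rfl⟩⟩

theorem IsProjectionStep.variational_inequality (hε : 0 ≤ ε) (hA : A.rank = m ∨ 0 < ε)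
    {z x : EuclideanSpace ℝ (Fin n)} (h : IsProjectionStep A b ε z x) :
    x ∈ constraintSet A b ε ∧ ∀ u ∈ constraintSet A b ε, inner ℝ (z - x) (u - x) ≤ 0 := by
  rcases le_or_gt ‖A.toEuclideanLin z - b‖ ε with hle | hgt
  · rw [h.1 hle]
    exact ⟨hle, fun u _ => by simp⟩
  · obtain ⟨τ, hτ, rfl⟩ := h.2 hgt
    exact variational_inequality_of_isTau hε hA hτ

theorem IsProjectionStep.isDRStep (hε : 0 ≤ ε) (hα : 0 < α) (hf : ClosedConvexProper f)
    (hA : A.rank = m ∨ 0 < ε) {z x p : EuclideanSpace ℝ (Fin n)}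
    (hx : IsProjectionStep A b ε z x) (hp : IsProx α f ((2 : ℝ) • x - z) p) :
    IsDRStep (constraintSet A b ε) (dom f) (fun u => α * (f u).toReal) z x p where
  mem_left := (hx.variational_inequality hε hA).1
  left := (hx.variational_inequality hε hA).2
  mem_right := (hf.proximal_inequality hα hp).1
  right := (hf.proximal_inequality hα hp).2

end Iteration

end PP

open PP in
theorem theorem1 {m n : ℕ} (f : EuclideanSpace ℝ (Fin n) → EReal)
    (A : Matrix (Fin m) (Fin n) ℝ) (b : EuclideanSpace ℝ (Fin m)) (ε α : ℝ)
    (hε : 0 ≤ ε) (hα : 0 < α)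
    (hC1 : PP.ClosedConvexProper f)
    (hC2 : A.rank = m ∨ 0 < ε)
    (hC3 : b ∈ LinearMap.range A.toEuclideanLin)
    (hC4 : PP.Coercive f ∨ Bornology.IsBounded (PP.constraintSet A b ε))
    (hC5 : ∃ x ∈ intrinsicInterior ℝ (PP.dom f),
      (ε = 0 → A.toEuclideanLin x = b) ∧ (0 < ε → ‖A.toEuclideanLin x - b‖ < ε)) :
    -- from every starting point the iteration is well defined
    (∀ z₁ : EuclideanSpace ℝ (Fin n),
      ∃! s : (ℕ → EuclideanSpace ℝ (Fin n)) × (ℕ → EuclideanSpace ℝ (Fin n)),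
        s.2 0 = z₁ ∧ PP.IsPPSequence f A b ε α s.1 s.2) ∧
    -- and whatever it generates converges, with feasible iterates
    ∀ x z : ℕ → EuclideanSpace ℝ (Fin n), PP.IsPPSequence f A b ε α x z →
      (∃ zlim, Tendsto z atTop (𝓝 zlim)) ∧
      (∃ xlim, Tendsto x atTop (𝓝 xlim) ∧
        xlim ∈ PP.constraintSet A b ε ∧ IsMinOn f (PP.constraintSet A b ε) xlim) ∧
      (∀ k, PP.IsProjection (PP.constraintSet A b ε) (z k) (x k)) ∧
      (∀ k, ‖A.toEuclideanLin (x k) - b‖ ≤ ε) := by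
  choose X hX using exists_isProjectionStep hε hC2 hC3
  choose P hP using fun z => hC1.exists_isProx hα ((2 : ℝ) • X z - z)
  have hXP : ∀ z, IsDRStep (constraintSet A b ε) (dom f) (fun u => α * (f u).toReal) z
      (X z) (P z) :=
    fun z => (hX z).isDRStep hε hα hC1 hC2 (hP z)
  -- Uniqueness of τ is not needed: whichever τ is used, the variational inequality determines x.
  have huniq : ∀ {z x p : EuclideanSpace ℝ (Fin n)},
      IsDRStep (constraintSet A b ε) (dom f) (fun u => α * (f u).toReal) z x p →
      x = X z ∧ p = P z := by
    intro z x p h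
    have hx : x = X z := by
      have := h.norm_left_sub_le (hXP z)
      rw [sub_self, norm_zero, norm_le_zero_iff, sub_eq_zero] at this
      exact this
    subst hx
    exact ⟨rfl, eq_of_proximal_inequality h.mem_right (hXP z).mem_right h.right (hXP z).right⟩
  set T : EuclideanSpace ℝ (Fin n) → EuclideanSpace ℝ (Fin n) := fun z => z + P z - X z with hT
  have hrec : ∀ x z, IsPPSequence f A b ε α x z → ∀ k, x k = X (z k) ∧ z (k + 1) = T (z k) := by
    intro x z h k
    obtain ⟨p, hp, hz⟩ := h.z_succ k
    obtain ⟨h1, h2⟩ := huniq (IsProjectionStep.isDRStep hε hα hC1 hC2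
      ⟨h.x_of_le k, h.x_of_lt k⟩ hp)
    exact ⟨h1, by rw [hz, h1, h2]⟩
  refine ⟨fun z₁ => ?_, fun x z h => ?_⟩
  · refine ⟨(fun k => X (T^[k] z₁), fun k => T^[k] z₁), ⟨rfl, ?_, ?_, ?_⟩, ?_⟩
    · exact fun k => (hX _).1
    · exact fun k => (hX _).2
    · exact fun k => ⟨P (T^[k] z₁), hP _, Function.iterate_succ_apply' T k z₁⟩
    · rintro ⟨x, z⟩ ⟨h0, h⟩
      have hz : ∀ k, z k = T^[k] z₁ := by
        intro k
        induction k with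
        | zero => exact h0
        | succ k ih => rw [(hrec x z h k).2, ih, Function.iterate_succ_apply']
      exact Prod.ext (funext fun k => (hrec x z h k).1.trans (congrArg X (hz k))) (funext hz)
  · obtain ⟨z₀, x₀, h₀⟩ := exists_stationary hε hα hC1 hC4 hC5
    obtain ⟨w, hw, hlim⟩ := exists_tendsto_of_firmlyNonexpansive (T := T)
      (fun u v => (hXP u).firmlyNonexpansive (hXP v))
      ⟨z₀, by simp only [hT]; rw [← (huniq h₀).1, ← (huniq h₀).2, add_sub_cancel_right]⟩
      (fun k => (hrec x z h k).2)
    have hPX : P w = X w := by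
      have : w + P w - X w = w := hw
      rwa [add_sub_assoc, add_eq_left, sub_eq_zero] at this
    have hstat := hXP w
    rw [hPX] at hstat
    have hproj : ∀ k, x k ∈ constraintSet A b ε ∧
        ∀ u ∈ constraintSet A b ε, inner ℝ (z k - x k) (u - x k) ≤ 0 := fun k => by
      rw [(hrec x z h k).1]
      exact (hX (z k)).variational_inequality hε hC2
    refine ⟨⟨w, hlim⟩, ⟨X w, ?_, hstat.mem_left, fun u hu => ?_⟩,
      fun k => isProjection_of_variational_inequality (hproj k).1 (hproj k).2,
      fun k => (hproj k).1⟩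
    · rw [tendsto_iff_norm_sub_tendsto_zero] at hlim ⊢
      refine squeeze_zero (fun k => norm_nonneg _) (fun k => ?_) hlim
      rw [(hrec x z h k).1]
      -- Nonexpansiveness of the projection carries the convergence of z over to x.
      exact (hXP (z k)).norm_left_sub_le (hXP w)
    · change f (X w) ≤ f u
      by_cases huD : u ∈ dom f
      · have := le_of_mul_le_mul_left (hstat.le_of_eq u hu huD) hα
        rwa [hC1.toReal_le_iff hstat.mem_right, hC1.coe_toReal huD] at this
      · rw [show f u = ⊤ from not_lt_top_iff.1 huD]
        exact le_top
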